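/- Let $p$ be a prime, let $\mathcal A=\mathbb Z/p\mathbb Z$ (discrete), let $D\ge 1$, and give the configuration space $X=\mathcal A^{\mathbb Z^D}$ the product topology and componentwise addition. For $u\in\mathbb Z^D$ let $\sigma^u:X\to X$ be the shift, $(\sigma^u a)_m=a_{u+m}$. A linear cellular automaton on $X$ is a continuous group endomorphism $F:X\to X$ that commutes with all shifts; it can be written uniquely as a shift polynomial $F=\sum_{u} f_u\,\sigma^u$ with coefficients $f_u\in\mathcal A$, only finitely many of them nonzero. Call $F$ nontrivial if at least two of the coefficients $f_u$ are nonzero. A character of $X$ is a continuous homomorphism $\chi$ from $X$ to the unit circle group. Its component $\chi_m$ at $m\in\mathbb Z^D$ is the character of $\mathcal A$ obtained by restricting $\chi$ to the $m$-th coordinate copy of $\mathcal A$ in $X$, so that $\chi(a)=\prod_m\chi_m(a_m)$ with all but finitely many $\chi_m$ trivial. The rank of $\chi$ is the number of $m$ for which $\chi_m$ is nontrivial. A set $J\subseteq\mathbb N$ has Cesàro density $1$ if $\frac1N\,\bigl|\{j\in J: 0\le j<N\}\bigr|\to 1$ as $N\to\infty$. **Theorem.** Every nontrivial linear cellular automaton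 $F$ on $\mathcal A^{\mathbb Z^D}$ is diffusive in density: for every nontrivial character $\chi$ of $\mathcal A^{\mathbb Z^D}$ there is a set $J\subseteq\mathbb N$ of Cesàro density $1$ such that $$\lim_{\substack{j\to\infty\\ j\in J}}\operatorname{rank}(\chi\circ F^j)=\infty .$$ -/

import Mathlib

open Filter Topology

noncomputable section

namespace CellAut

variable {M A : Type*} [AddCommMonoid M] [AddCommGroup A] [TopologicalSpace A]

/-- The shift `σ^e` on the configuration space `A^M`: `(σ^e a)_m = a_{e+m}`. -/
def shift (e : M) (a : M → A) : M → A := fun m => a (e + m)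

/-- A linear cellular automaton on `A^M`: a group endomorphism of `A^M` that is continuous for the
product topology and commutes with all shifts. -/
structure IsLinearCA (F : AddMonoid.End (M → A)) : Prop where
  continuous : Continuous (F : (M → A) → (M → A))
  commutes : ∀ (e : M) (a : M → A), F (shift e a) = shift e (F a)

open Classical in
/-- The component `χ_m` at `m ∈ M` of a character `χ` of `A^M`: the character of `A` obtained by
restricting `χ` to the `m`-th coordinate copy of `A`. -/
def component (χ : AddChar (M → A) Circle) (m : M) : AddChar A Circle :=
  χ.compAddMonoidHom (AddMonoidHom.single (fun _ : M => A) m)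

/-- The rank of a character of `A^M`: the number of its nontrivial components.  (This number is
finite when `χ` is continuous, see `finite_components` for `A = ℤ/n`.) -/
def rank (χ : AddChar (M → A) Circle) : ℕ := {m : M | component χ m ≠ 1}.ncard

open Classical in
/-- The set `J` of natural numbers has Cesàro density `d`. -/
def HasCesaroDensity (J : Set ℕ) (d : ℝ) : Prop :=
  Tendsto (fun N : ℕ => (((Finset.range N).filter (fun j => j ∈ J)).card : ℝ) / (N : ℝ))
    atTop (𝓝 d)

/-- `F` is diffusive in density: for every nontrivial (continuous) character `χ` of `A^M` there is
a set `J` of Cesàro density one such that `rank (χ ∘ F^j) → ∞` as `j → ∞` within `J`. -/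
def IsDiffusiveInDensity (F : AddMonoid.End (M → A)) : Prop :=
  ∀ χ : AddChar (M → A) Circle, Continuous χ → χ ≠ 1 →
    ∃ J : Set ℕ, HasCesaroDensity J 1 ∧
      Tendsto (fun j : ℕ => rank (χ.compAddMonoidHom (F ^ j))) (atTop ⊓ 𝓟 J) atTop

section ZModAlphabet

variable {n : ℕ}

/-- `f`, a finitely supported family of coefficients in `ℤ/n`, is a shift polynomial of `F`:
`F = ∑_u f_u σ^u`. -/
def IsShiftPolynomial (F : AddMonoid.End (M → ZMod n)) (f : M →₀ ZMod n) : Prop :=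
  ∀ a : M → ZMod n, F a = f.sum fun u c => c • shift u a

/-- `F` is nontrivial: its shift polynomial (which exists and is unique for every linear cellular
automaton, see `existsUnique_shiftPolynomial`) has at least two nonzero coefficients. -/
def IsNontrivial (F : AddMonoid.End (M → ZMod n)) : Prop :=
  ∃ f : M →₀ ZMod n, IsShiftPolynomial F f ∧ 2 ≤ f.support.card

theorem exists_finset_of_isOpen {ι : Type*} {S : Set (ι → ZMod n)} (hS : IsOpen S) (h0 : 0 ∈ S) :
    ∃ I : Finset ι, ∀ a : ι → ZMod n, (∀ m ∈ I, a m = 0) → a ∈ S := by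
  obtain ⟨I, u, hu, hIS⟩ := isOpen_pi_iff.1 hS 0 h0
  refine ⟨I, fun a ha => hIS fun m hm => ?_⟩
  rw [ha m hm]
  exact (hu m hm).2

open Classical in
theorem existsUnique_shiftPolynomial {F : AddMonoid.End (M → ZMod n)} (hF : IsLinearCA F) :
    ∃! f : M →₀ ZMod n, IsShiftPolynomial F f := by
  have key : ∀ (a : M → ZMod n) (m : M), F a m = F (shift m a) 0 := by
    intro a m
    rw [hF.commutes]
    simp [shift]
  have hopen : IsOpen {a : M → ZMod n | F a 0 = 0} :=
    (isOpen_discrete ({0} : Set (ZMod n))).preimage ((continuous_apply 0).comp hF.continuous)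
  obtain ⟨I, hI⟩ := exists_finset_of_isOpen hopen (by simp)
  have hloc : ∀ a : M → ZMod n, F a 0 = ∑ u ∈ I, F (Pi.single u 1) 0 * a u := by
    intro a
    have h1 : F (a - ∑ u ∈ I, Pi.single u (a u)) 0 = 0 := by
      apply hI
      intro m hm
      simp [Finset.sum_apply, Pi.single_apply, hm]
    have h2 : ∀ u, F (Pi.single u (a u)) 0 = F (Pi.single u 1) 0 * a u := by
      intro u
      obtain ⟨k, hk⟩ := ZMod.intCast_surjective (a u)
      have : (Pi.single u (a u) : M → ZMod n) = k • Pi.single u 1 := by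
        rw [← Pi.single_smul', ← hk]; simp
      rw [this, map_zsmul, ← hk]
      simp [mul_comm]
    rw [map_sub, map_sum, Pi.sub_apply, sub_eq_zero, Finset.sum_apply] at h1
    rw [h1]
    exact Finset.sum_congr rfl fun u _ => h2 u
  have hsum : ∀ (f : M →₀ ZMod n) (a : M → ZMod n) (m : M),
      (f.sum fun u c => c • shift u a) m = f.sum fun u c => c * a (u + m) := by
    intro f a m
    simp [Finsupp.sum, Finset.sum_apply, shift]
  refine ⟨Finsupp.onFinset I (fun u => if u ∈ I then F (Pi.single u 1) 0 else 0) ?_, ?_, ?_⟩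
  · intro u hu
    by_contra h
    simp [h] at hu
  · intro a
    funext m
    rw [hsum, Finsupp.onFinset_sum _ (by simp), key, hloc]
    refine Finset.sum_congr rfl fun u hu => ?_
    simp [hu, shift, add_comm]
  · intro g hg
    ext v
    have h := congrFun (hg (Pi.single v 1)) 0
    rw [hsum] at h
    have h3 : (g.sum fun u c => c * (Pi.single v 1 : M → ZMod n) (u + 0)) = g v := by
      simp [Finsupp.sum, Pi.single_apply]
      tauto
    rw [h3] at h
    rw [← h, hloc]
    simp [Pi.single_apply]

/-- A continuous character of `(ℤ/n)^M` has only finitely many nontrivial components. -/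
theorem finite_components [NeZero n] {χ : AddChar (M → ZMod n) Circle} (hχ : Continuous χ) :
    {m : M | component χ m ≠ 1}.Finite := by
  classical
  have hpow : ∀ a, ((χ a : Circle) : ℂ) ^ n = 1 := by
    intro a
    have : χ (n • a) = χ a ^ n := χ.map_nsmul_eq_pow n a
    have h0 : n • a = 0 := by funext m; simp
    rw [h0, χ.map_zero_eq_one] at this
    rw [← Circle.coe_pow, ← this, Circle.coe_one]
  have hfin : {z : ℂ | z ^ n = 1 ∧ z ≠ 1}.Finite := by
    refine (Polynomial.nthRoots n (1 : ℂ)).toFinset.finite_toSet.subset ?_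
    intro z hz
    simp [Polynomial.mem_nthRoots (NeZero.pos n), hz.1]
  have hopen : IsOpen {a : M → ZMod n | χ a = 1} := by
    have : {a : M → ZMod n | χ a = 1} =
        (fun a => ((χ a : Circle) : ℂ)) ⁻¹' {z : ℂ | z ^ n = 1 ∧ z ≠ 1}ᶜ := by
      ext a
      simp [hpow a]
      exact Circle.ext_iff
    rw [this]
    exact hfin.isClosed.isOpen_compl.preimage (continuous_subtype_val.comp hχ)
  obtain ⟨I, hI⟩ := exists_finset_of_isOpen hopen (by simp)
  refine I.finite_toSet.subset fun m hm => ?_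
  by_contra hmI
  apply hm
  ext x
  have : χ (Pi.single m x) = 1 := by
    apply hI
    intro k hk
    have : k ≠ m := fun h => hmI (h ▸ hk)
    simp [this]
  simp only [component, AddChar.compAddMonoidHom_apply, AddMonoidHom.single_apply,
    AddChar.one_apply]
  exact congrArg (fun z : Circle => (z : ℂ)) this

end ZModAlphabet

end CellAut

end

/-! Characters of `(ℤ/p)^(ℤ^D)` correspond to Laurent polynomials `G` over `𝔽_p`; the rank is the
number of terms, and composing with `F` multiplies `G` by `f`. So `G * f ^ j` must gain terms
without bound along a set of density one. Let `q = p ^ s`. By Frobenius `f ^ (q * k)` is `f ^ k`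
with exponents scaled by `q`, so each residue class of exponents mod `q` in `g * f ^ (r + q * k)`
carries a product `h * f ^ k`, with `h` a residue part of `g * f ^ r`. Such `h` stay in one fixed
box, so digits of `j` can be stripped repeatedly. For large `q` some digit `r ≤ 1` leaves two
nonempty classes, which costs a term (`exists_digit_numTerms_lt`). Hence the sum of `2 ^
(-numTerms)` over `j < q ^ n` is at most `(q - 1/2) ^ n` (`sum_half_pow_numTerms_le`), and Markov's
inequality yields the density statement. -/

open Filter Topology

namespace CellAut

/-! ### Counting terms in group algebras. -/

section Terms

variable {R M : Type*} [Semiring R]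

/-- The number of terms of an element of an additive monoid algebra. -/
def numTerms (g : AddMonoidAlgebra R M) : ℕ := g.coeff.support.card

theorem numTerms_pos {g : AddMonoidAlgebra R M} (hg : g ≠ 0) : 1 ≤ numTerms g := by
  rw [numTerms, Nat.one_le_iff_ne_zero, Finset.card_ne_zero, Finsupp.support_nonempty_iff]
  simpa using hg

/-- If `f` has at least two terms and `g ≠ 0`, then `g` or `g * f` has at least two terms. -/
theorem exists_two_le_numTerms_mul_pow [AddGroup M] [NoZeroDivisors R]
    {f g : AddMonoidAlgebra R M} (hf : 2 ≤ numTerms f) (hg : g ≠ 0) :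
    ∃ r ≤ 1, 2 ≤ numTerms (g * f ^ r) := by
  by_cases h : 2 ≤ numTerms g
  · exact ⟨0, by simp, by simpa using h⟩
  · have h1 : g.coeff.support.card = 1 := by
      have := numTerms_pos hg
      unfold numTerms at *
      omega
    obtain ⟨u, b, hb, hgu⟩ := Finsupp.card_support_eq_one'.1 h1
    have hgs : g = AddMonoidAlgebra.single u b := AddMonoidAlgebra.coeff_injective hgu
    refine ⟨1, le_rfl, ?_⟩
    rw [pow_one, numTerms, hgs, AddMonoidAlgebra.support_coeff_single_mul]
    · simpa [numTerms] using hf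
    · intro y
      simp [hb]

end Terms

/-! ### Splitting Laurent polynomials by exponents mod `q`. -/

section Residue

variable {R ι : Type*} [CommSemiring R]

theorem add_nsmul_injective (q : ℕ) [NeZero q] (c : ι → ℤ) :
    Function.Injective fun y : ι → ℤ => c + q • y := by
  intro y y' h
  funext i
  have := congrFun h i
  simpa [NeZero.ne q] using this

/-- The residue vector of `u` modulo `q`, with entries in `[0, q)`. -/
def residue (q : ℕ) (u : ι → ℤ) : ι → ℤ := fun i => u i % q

theorem residue_add_nsmul_div (q : ℕ) (u : ι → ℤ) : residue q u + q • (fun i => u i / q) = u := by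
  funext i
  simpa [residue] using Int.emod_add_mul_ediv (u i) q

theorem residue_residue_add_nsmul (q : ℕ) (u y : ι → ℤ) :
    residue q (residue q u + q • y) = residue q u := by
  funext i
  simp [residue]

/-- The coefficients of `g` at the exponents congruent to `c` modulo `q`: the Laurent polynomial
whose coefficient at `y` is that of `g` at `c + q y`. -/
noncomputable def residuePart (q : ℕ) [NeZero q] (c : ι → ℤ) (g : AddMonoidAlgebra R (ι → ℤ)) :
    AddMonoidAlgebra R (ι → ℤ) :=
  .ofCoeff (g.coeff.comapDomain (fun y => c + q • y) (add_nsmul_injective q c).injOn)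

variable (q : ℕ) [NeZero q] (c : ι → ℤ)

@[simp]
theorem coeff_residuePart (g : AddMonoidAlgebra R (ι → ℤ)) (y : ι → ℤ) :
    (residuePart q c g).coeff y = g.coeff (c + q • y) := rfl

@[simp]
theorem residuePart_zero : residuePart q c (0 : AddMonoidAlgebra R (ι → ℤ)) = 0 := by
  ext y
  simp

theorem residuePart_add (g g' : AddMonoidAlgebra R (ι → ℤ)) :
    residuePart q c (g + g') = residuePart q c g + residuePart q c g' := by
  ext y
  simp

theorem residuePart_single_add (y : ι → ℤ) (a : R) :
    residuePart q c (.single (c + q • y) a) = .single y a := by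
  classical
  ext z
  rw [coeff_residuePart, AddMonoidAlgebra.coeff_single, AddMonoidAlgebra.coeff_single,
    Finsupp.single_apply, Finsupp.single_apply]
  exact if_congr (add_nsmul_injective q c).eq_iff rfl rfl

theorem residuePart_single_of_ne {u : ι → ℤ} (hu : ∀ y : ι → ℤ, c + q • y ≠ u) (a : R) :
    residuePart q c (.single u a) = 0 := by
  classical
  ext z
  rw [coeff_residuePart, AddMonoidAlgebra.coeff_single, Finsupp.single_apply,
    if_neg (hu z).symm]
  rfl

/-- The second factor has exponents in `q ℤ^ι`, so multiplying by it preserves every residue class.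
-/
theorem residuePart_mul_mapDomain (g h : AddMonoidAlgebra R (ι → ℤ)) :
    residuePart q c (g * h.mapDomain (q • ·)) = residuePart q c g * h := by
  induction g using AddMonoidAlgebra.induction_linear with
  | zero => simp
  | add g g' hg hg' => rw [add_mul, residuePart_add, hg, hg', residuePart_add, add_mul]
  | single u a =>
  induction h using AddMonoidAlgebra.induction_linear with
  | zero => simp [AddMonoidAlgebra.mapDomain_zero]
  | add h h' hh hh' =>
    rw [AddMonoidAlgebra.mapDomain_add, mul_add, residuePart_add, hh, hh', mul_add]
  | single v b =>
    rw [AddMonoidAlgebra.mapDomain_single, AddMonoidAlgebra.single_mul_single]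
    by_cases hu : ∃ y : ι → ℤ, c + q • y = u
    · obtain ⟨y, rfl⟩ := hu
      rw [add_assoc, ← smul_add, residuePart_single_add, residuePart_single_add,
        AddMonoidAlgebra.single_mul_single]
    · push Not at hu
      rw [residuePart_single_of_ne q c hu, residuePart_single_of_ne, zero_mul]
      intro y hy
      apply hu (y - v)
      rw [smul_sub, ← add_sub_assoc, hy, add_sub_cancel_right]

theorem residuePart_mul_mapDomain_pow (g h : AddMonoidAlgebra R (ι → ℤ)) (k : ℕ) :
    residuePart q c (g * h.mapDomain (q • ·) ^ k) = residuePart q c g * h ^ k := by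
  induction k with
  | zero => simp
  | succ k ih => rw [pow_succ, ← mul_assoc, residuePart_mul_mapDomain, ih, pow_succ, mul_assoc]

theorem numTerms_residuePart_le (g : AddMonoidAlgebra R (ι → ℤ)) :
    numTerms (residuePart q c g) ≤ numTerms g := by
  refine Finset.card_le_card_of_injOn (fun y => c + q • y) ?_ (add_nsmul_injective q c).injOn
  intro y hy
  simpa using hy

theorem numTerms_residuePart_add_le {c c' : ι → ℤ} (hc : ∀ y y' : ι → ℤ, c + q • y ≠ c' + q • y')
    (g : AddMonoidAlgebra R (ι → ℤ)) :
    numTerms (residuePart q c g) + numTerms (residuePart q c' g) ≤ numTerms g := by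
  classical
  rw [numTerms, numTerms, ← Finset.card_image_of_injective _ (add_nsmul_injective q c),
    ← Finset.card_image_of_injective (residuePart q c' g).coeff.support
      (add_nsmul_injective q c'), ← Finset.card_union_of_disjoint]
  · refine Finset.card_le_card ?_
    intro u hu
    simp only [Finset.mem_union, Finset.mem_image, Finsupp.mem_support_iff, coeff_residuePart]
      at hu ⊢
    rcases hu with ⟨y, hy, rfl⟩ | ⟨y, hy, rfl⟩ <;> exact hy
  · rw [Finset.disjoint_left]
    intro u hu hu'
    obtain ⟨y, -, hy⟩ := Finset.mem_image.1 hu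
    obtain ⟨y', -, hy'⟩ := Finset.mem_image.1 hu'
    exact hc y y' (hy.trans hy'.symm)

/-- All exponents of `g` lie in the box `[-d, d]^ι`. -/
def InBox (d : ℕ) (g : AddMonoidAlgebra R (ι → ℤ)) : Prop :=
  ∀ u : ι → ℤ, g.coeff u ≠ 0 → ∀ i, |u i| ≤ d

theorem InBox.mono {a b : ℕ} (hab : a ≤ b) {g : AddMonoidAlgebra R (ι → ℤ)} (hg : InBox a g) :
    InBox b g :=
  fun u hu i => (hg u hu i).trans (by exact_mod_cast hab)

theorem exists_inBox [Fintype ι] (g : AddMonoidAlgebra R (ι → ℤ)) : ∃ d, InBox d g := by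
  refine ⟨g.coeff.support.sup fun u => Finset.univ.sup fun i => (u i).natAbs, fun u hu i => ?_⟩
  have h1 : (u i).natAbs ≤ Finset.univ.sup fun i => (u i).natAbs :=
    Finset.le_sup (f := fun i => (u i).natAbs) (Finset.mem_univ i)
  have h2 := Finset.le_sup (f := fun u : ι → ℤ => Finset.univ.sup fun i => (u i).natAbs)
    (Finsupp.mem_support_iff.2 hu)
  rw [Int.abs_eq_natAbs]
  exact_mod_cast h1.trans h2

theorem InBox.mul {a b : ℕ} {g h : AddMonoidAlgebra R (ι → ℤ)} (hg : InBox a g)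
    (hh : InBox b h) : InBox (a + b) (g * h) := by
  classical
  intro u hu i
  obtain ⟨v, hv, w, hw, rfl⟩ := Finset.mem_add.1
    (AddMonoidAlgebra.support_coeff_mul_subset g h (Finsupp.mem_support_iff.2 hu))
  have h1 := hg v (Finsupp.mem_support_iff.1 hv) i
  have h2 := hh w (Finsupp.mem_support_iff.1 hw) i
  push_cast
  exact (abs_add_le _ _).trans (add_le_add h1 h2)

theorem InBox.mul_pow {a b : ℕ} {g h : AddMonoidAlgebra R (ι → ℤ)} (hg : InBox a g)
    (hh : InBox b h) (r : ℕ) : InBox (a + r * b) (g * h ^ r) := by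
  induction r with
  | zero => simpa using hg
  | succ r ih =>
    rw [pow_succ, ← mul_assoc, add_one_mul, ← add_assoc]
    exact ih.mul hh

/-- Dividing exponents by `q` shrinks the box by `q`; the offset in `[0, q)` costs less than one
unit below, which integrality absorbs. -/
theorem InBox.residuePart {d : ℕ} {g : AddMonoidAlgebra R (ι → ℤ)} (hg : InBox (q * d) g)
    (u : ι → ℤ) : InBox d (residuePart q (residue q u) g) := by
  intro y hy i
  have h : -((q : ℤ) * d) ≤ u i % q + q * y i ∧ u i % q + q * y i ≤ (q : ℤ) * d := by
    simpa [residue] using abs_le.1 (hg _ hy i)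
  have hq : (0 : ℤ) < q := by exact_mod_cast NeZero.pos q
  have h0 := Int.emod_nonneg (u i) hq.ne'
  have h1 := Int.emod_lt_of_pos (u i) hq
  rw [abs_le]
  constructor
  · have : (q : ℤ) * (-d) < q * (y i + 1) := by linarith [h.1]
    have := lt_of_mul_lt_mul_left this hq.le
    omega
  · have : (q : ℤ) * y i ≤ q * d := by linarith [h.2]
    exact le_of_mul_le_mul_left this hq

theorem residuePart_residue_ne_zero {g : AddMonoidAlgebra R (ι → ℤ)} {u : ι → ℤ}
    (hu : g.coeff u ≠ 0) : residuePart q (residue q u) g ≠ 0 := by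
  intro h
  have : (residuePart q (residue q u) g).coeff (fun i => u i / q) = 0 := by rw [h]; rfl
  rw [coeff_residuePart, residue_add_nsmul_div] at this
  exact hu this

end Residue

/-! ### Frobenius on the group algebra over `𝔽_p`. -/

section Frobenius

variable {p : ℕ} [Fact p.Prime] {M : Type*} [AddCommMonoid M]

theorem pow_prime_pow_eq_mapDomain (f : AddMonoidAlgebra (ZMod p) M) (s : ℕ) :
    f ^ p ^ s = f.mapDomain (p ^ s • ·) := by
  have : CharP (AddMonoidAlgebra (ZMod p) M) p :=
    charP_of_injective_algebraMap (algebraMap (ZMod p) (AddMonoidAlgebra (ZMod p) M)).injective p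
  induction f using AddMonoidAlgebra.induction_linear with
  | zero => simp [AddMonoidAlgebra.mapDomain_zero, (Fact.out : p.Prime).ne_zero]
  | add f g hf hg => rw [add_pow_char_pow, hf, hg, AddMonoidAlgebra.mapDomain_add]
  | single u a =>
    rw [AddMonoidAlgebra.single_pow, AddMonoidAlgebra.mapDomain_single, ZMod.pow_card_pow]

end Frobenius

/-! ### Digit recursion and the exponential moment bound. -/

section Potential

variable {p : ℕ} [Fact p.Prime] {ι : Type*}

theorem sum_range_pow_succ (q n : ℕ) (F : ℕ → ℝ) :
    ∑ j ∈ Finset.range (q ^ (n + 1)), F j =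
      ∑ r ∈ Finset.range q, ∑ k ∈ Finset.range (q ^ n), F (r + q * k) := by
  rw [Finset.sum_comm]
  rw [← Finset.sum_product', pow_succ]
  rcases Nat.eq_zero_or_pos q with rfl | hq
  · simp
  refine (Finset.sum_nbij' (fun x => x.2 + q * x.1) (fun j => (j / q, j % q)) ?_ ?_ ?_ ?_ ?_).symm
  · rintro ⟨k, r⟩ h
    simp only [Finset.mem_product, Finset.mem_range] at h ⊢
    nlinarith [h.1, h.2]
  · intro j h
    simp only [Finset.mem_product, Finset.mem_range] at h ⊢
    exact ⟨Nat.div_lt_of_lt_mul (by rwa [mul_comm]), Nat.mod_lt _ hq⟩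
  · rintro ⟨k, r⟩ h
    simp only [Finset.mem_product, Finset.mem_range] at h
    simp [Nat.add_mul_div_left _ _ hq, Nat.div_eq_of_lt h.2, Nat.mod_eq_of_lt h.2]
  · intro j _
    exact Nat.mod_add_div j q
  · intros; rfl

variable {f : AddMonoidAlgebra (ZMod p) (ι → ℤ)} {d s : ℕ}

/-- The digit recursion: passing to a residue part modulo `p ^ s` removes the lowest digit of the
exponent and does not increase the number of terms. -/
theorem exists_numTerms_le_of_digit (hf : InBox d f) {g : AddMonoidAlgebra (ZMod p) (ι → ℤ)}
    (hg : g ≠ 0) (hgd : InBox d g) (hf0 : f ≠ 0) {r : ℕ} (hr : r < p ^ s) :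
    ∃ h : AddMonoidAlgebra (ZMod p) (ι → ℤ), h ≠ 0 ∧ InBox d h ∧
      ∀ k, numTerms (h * f ^ k) ≤ numTerms (g * f ^ (r + p ^ s * k)) := by
  -- The box has size `(r + 1) * d`, and `r + 1 ≤ p ^ s`.
  have hbox : InBox (p ^ s * d) (g * f ^ r) :=
    (hgd.mul_pow hf r).mono (by nlinarith)
  have h0 : (g * f ^ r).coeff ≠ 0 := by
    simpa using mul_ne_zero hg (pow_ne_zero r hf0)
  obtain ⟨u, hu⟩ := DFunLike.ne_iff.1 h0
  refine ⟨residuePart (p ^ s) (residue (p ^ s) u) (g * f ^ r),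
    residuePart_residue_ne_zero _ hu, hbox.residuePart _ u, fun k => ?_⟩
  rw [← residuePart_mul_mapDomain_pow, ← pow_prime_pow_eq_mapDomain, ← pow_mul, mul_assoc,
    ← pow_add]
  exact numTerms_residuePart_le _ _ _

/-- For one of the two lowest digits, the digit recursion loses at least one term. -/
theorem exists_digit_numTerms_lt (hf : InBox d f) (hf2 : 2 ≤ numTerms f)
    {g : AddMonoidAlgebra (ZMod p) (ι → ℤ)} (hg : g ≠ 0) (hgd : InBox d g)
    (hs : 4 * d + 1 < p ^ s) :
    ∃ r < p ^ s, ∃ h : AddMonoidAlgebra (ZMod p) (ι → ℤ), h ≠ 0 ∧ InBox d h ∧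
      ∀ k, numTerms (h * f ^ k) + 1 ≤ numTerms (g * f ^ (r + p ^ s * k)) := by
  have hf0 : f ≠ 0 := by
    rintro rfl
    simp [numTerms] at hf2
  obtain ⟨r, hr, hr2⟩ := exists_two_le_numTerms_mul_pow hf2 hg
  -- The `+ 1` in `hs` ensures `r ≤ 1 < p ^ s` even when `d = 0`.
  refine ⟨r, by omega, ?_⟩
  have hbox2 : InBox (2 * d) (g * f ^ r) :=
    (hgd.mul_pow hf r).mono (by nlinarith)
  have hbox : InBox (p ^ s * d) (g * f ^ r) := hbox2.mono (Nat.mul_le_mul_right d (by omega))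
  obtain ⟨u, hu, v, hv, huv⟩ := Finset.one_lt_card.1 hr2
  rw [Finsupp.mem_support_iff] at hu hv
  have hc : ∀ y y' : ι → ℤ,
      residue (p ^ s) u + p ^ s • y ≠ residue (p ^ s) v + p ^ s • y' := by
    intro y y' h
    have h' := congrArg (residue (p ^ s)) h
    rw [residue_residue_add_nsmul, residue_residue_add_nsmul] at h'
    apply huv
    funext i
    have hi : u i % (p ^ s : ℕ) = v i % (p ^ s : ℕ) := congrFun h' i
    have h1 := abs_le.1 (hbox2 u hu i)
    have h2 := abs_le.1 (hbox2 v hv i)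
    -- Two exponents in the box of size `2 * d` differ by at most `4 * d` in each coordinate, so
    -- congruence mod `p ^ s` would force equality.
    have h3 : |u i - v i| < (p ^ s : ℕ) := by
      rw [abs_lt]
      push_cast at h1 h2
      have : ((4 * d + 1 : ℕ) : ℤ) < (p ^ s : ℕ) := by exact_mod_cast hs
      push_cast at this ⊢
      constructor <;> linarith [h1.1, h1.2, h2.1, h2.2]
    have h4 := Int.eq_zero_of_abs_lt_dvd (Int.ModEq.dvd hi.symm) h3
    linarith
  refine ⟨residuePart (p ^ s) (residue (p ^ s) u) (g * f ^ r),
    residuePart_residue_ne_zero _ hu, hbox.residuePart _ u, fun k => ?_⟩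
  have hv0 : residuePart (p ^ s) (residue (p ^ s) v) (g * f ^ r) * f ^ k ≠ 0 :=
    mul_ne_zero (residuePart_residue_ne_zero _ hv) (pow_ne_zero k hf0)
  refine (Nat.add_le_add_left (numTerms_pos hv0) _).trans ?_
  rw [← residuePart_mul_mapDomain_pow, ← residuePart_mul_mapDomain_pow,
    ← pow_prime_pow_eq_mapDomain, ← pow_mul, mul_assoc, ← pow_add]
  exact numTerms_residuePart_add_le _ hc _

/-- Induction on the number of digits, uniformly in `g`: the good lowest digit contributes a factor
`1/2`, each of the other `q - 1` a factor at most `1`, where `q = p ^ s`. -/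
theorem sum_half_pow_numTerms_le (hf : InBox d f) (hf2 : 2 ≤ numTerms f)
    (hs : 4 * d + 1 < p ^ s) (n : ℕ) {g : AddMonoidAlgebra (ZMod p) (ι → ℤ)} (hg : g ≠ 0)
    (hgd : InBox d g) :
    ∑ j ∈ Finset.range ((p ^ s) ^ n), (1 / 2 : ℝ) ^ numTerms (g * f ^ j) ≤
      (((p ^ s : ℕ) : ℝ) - 1 / 2) ^ n := by
  have hf0 : f ≠ 0 := by
    rintro rfl
    simp [numTerms] at hf2
  induction n generalizing g with
  | zero => simpa using pow_le_one₀ (by norm_num) (by norm_num : (2⁻¹ : ℝ) ≤ 1)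
  | succ n ih =>
    rw [sum_range_pow_succ]
    set A : ℝ := (((p ^ s : ℕ) : ℝ) - 1 / 2) ^ n
    obtain ⟨r₀, hr₀, h, h0, hd, hk⟩ := exists_digit_numTerms_lt hf hf2 hg hgd hs
    rw [← Finset.add_sum_erase _ _ (Finset.mem_range.2 hr₀)]
    have h1 : ∑ k ∈ Finset.range ((p ^ s) ^ n), (1 / 2 : ℝ) ^ numTerms (g * f ^ (r₀ + p ^ s * k))
        ≤ 1 / 2 * A := by
      refine le_trans ?_ (mul_le_mul_of_nonneg_left (ih h0 hd) (by norm_num))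
      rw [Finset.mul_sum]
      refine Finset.sum_le_sum fun k _ => ?_
      rw [← pow_succ']
      exact pow_le_pow_of_le_one (by norm_num) (by norm_num) (hk k)
    have h2 : ∀ r ∈ (Finset.range (p ^ s)).erase r₀,
        ∑ k ∈ Finset.range ((p ^ s) ^ n), (1 / 2 : ℝ) ^ numTerms (g * f ^ (r + p ^ s * k)) ≤ A := by
      intro r hr
      obtain ⟨h', h0', hd', hk'⟩ := exists_numTerms_le_of_digit hf hg hgd hf0
        (Finset.mem_range.1 (Finset.mem_of_mem_erase hr))
      refine le_trans (Finset.sum_le_sum fun k _ => ?_) (ih h0' hd')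
      exact pow_le_pow_of_le_one (by norm_num) (by norm_num) (hk' k)
    have h3 := Finset.sum_le_card_nsmul _ _ _ h2
    rw [Finset.card_erase_of_mem (Finset.mem_range.2 hr₀), Finset.card_range, nsmul_eq_mul,
      Nat.cast_sub (by omega)] at h3
    calc _ ≤ 1 / 2 * A + (((p ^ s : ℕ) : ℝ) - (1 : ℕ)) * A := add_le_add h1 h3
      _ = _ := by rw [pow_succ, Nat.cast_one]; ring

end Potential

/-! ### From moment bounds to divergence in density. -/

section Density

open Classical in
theorem hasCesaroDensity_one_of_compl {J : Set ℕ}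
    (h : Tendsto (fun N : ℕ => (((Finset.range N).filter (fun j => j ∉ J)).card : ℝ) / (N : ℝ))
      atTop (𝓝 0)) : HasCesaroDensity J 1 := by
  have h1 : Tendsto (fun N : ℕ =>
      1 - (((Finset.range N).filter (fun j => j ∉ J)).card : ℝ) / (N : ℝ)) atTop (𝓝 1) := by
    simpa using h.const_sub 1
  refine h1.congr' ?_
  filter_upwards [eventually_gt_atTop 0] with N hN
  have hcard := Finset.card_filter_add_card_filter_not (s := Finset.range N) (fun j => j ∈ J)
  rw [Finset.card_range] at hcard
  have hN' : (N : ℝ) ≠ 0 := by exact_mod_cast hN.ne'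
  have : (N : ℝ) = ((Finset.range N).filter (fun j => j ∈ J)).card +
      ((Finset.range N).filter (fun j => j ∉ J)).card := by exact_mod_cast hcard.symm
  rw [eq_div_iff hN', sub_mul, div_mul_cancel₀ _ hN']
  linarith

theorem tendsto_log_atTop {b : ℕ} (hb : 1 < b) : Tendsto (Nat.log b) atTop atTop := by
  refine tendsto_atTop_atTop.2 fun n => ⟨b ^ n, fun j hj => ?_⟩
  simpa [Nat.log_pow hb] using Nat.log_mono_right (b := b) hj

/-- A power saving in the exponential moments of `w` makes `w` tend to infinity in density. -/
theorem exists_density_one_tendsto_atTop {w : ℕ → ℕ} {q : ℕ} (hq : 1 < q)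
    (hw : ∀ n, ∑ j ∈ Finset.range (q ^ n), (1 / 2 : ℝ) ^ w j ≤ ((q : ℝ) - 1 / 2) ^ n) :
    ∃ J : Set ℕ, HasCesaroDensity J 1 ∧ Tendsto w (atTop ⊓ 𝓟 J) atTop := by
  classical
  -- The threshold tends to infinity so slowly that `2 ^ φ N ≤ log_q N`, which is beaten by the
  -- geometric saving `ρ ^ (log_q N)`.
  set φ : ℕ → ℕ := fun j => Nat.log 2 (Nat.log q j)
  have hφ : Tendsto φ atTop atTop := (tendsto_log_atTop one_lt_two).comp (tendsto_log_atTop hq)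
  have hφm : Monotone φ := fun a b hab => Nat.log_mono_right (Nat.log_mono_right hab)
  have hq0 : (0 : ℝ) < q := by exact_mod_cast zero_lt_one.trans hq
  have hq1 : (1 : ℝ) < q := by exact_mod_cast hq
  obtain ⟨J, hJ⟩ : ∃ J : Set ℕ, ∀ j, j ∈ J ↔ φ j ≤ w j := ⟨{j | φ j ≤ w j}, fun _ => Iff.rfl⟩
  refine ⟨J, hasCesaroDensity_one_of_compl ?_, ?_⟩
  · set ρ : ℝ := ((q : ℝ) - 1 / 2) / q
    have hρ0 : 0 ≤ ρ := div_nonneg (by linarith) hq0.le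
    have hρ1 : ρ < 1 := (div_lt_one hq0).2 (by linarith)
    have hlim : Tendsto (fun N : ℕ => ((q : ℝ) - 1 / 2) * ((Nat.log q N : ℝ) * ρ ^ Nat.log q N))
        atTop (𝓝 0) := by
      simpa using ((tendsto_self_mul_const_pow_of_lt_one hρ0 hρ1).comp
        (tendsto_log_atTop hq)).const_mul ((q : ℝ) - 1 / 2)
    refine squeeze_zero' (Eventually.of_forall fun N => by positivity) ?_ hlim
    filter_upwards [eventually_ge_atTop q] with N hN
    set L := Nat.log q N with hL
    have hN0 : N ≠ 0 := by omega
    have hL0 : L ≠ 0 := (Nat.log_pos hq hN).ne'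
    have hsub : Finset.range N ⊆ Finset.range (q ^ (L + 1)) :=
      Finset.range_subset_range.2 (Nat.lt_pow_succ_log_self hq N).le
    have hcard : (((Finset.range N).filter (fun j => j ∉ J)).card : ℝ) ≤
        L * ((q : ℝ) - 1 / 2) ^ (L + 1) := by
      calc (((Finset.range N).filter (fun j => j ∉ J)).card : ℝ)
          = ∑ j ∈ (Finset.range N).filter (fun j => j ∉ J), (1 : ℝ) := by simp
        _ ≤ ∑ j ∈ (Finset.range N).filter (fun j => j ∉ J),
            (L : ℝ) * (1 / 2) ^ w j := by
          refine Finset.sum_le_sum fun j hj => ?_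
          simp only [Finset.mem_filter, Finset.mem_range, hJ, not_le] at hj
          -- Markov: off `J`, `w j < φ j ≤ φ N`, so each bad `j` has weight at least `1`.
          have h1 : 2 ^ w j ≤ L := (Nat.pow_le_pow_right two_pos (hj.2.le.trans (hφm hj.1.le))).trans
            (Nat.pow_log_le_self 2 hL0)
          have h2 : (2 : ℝ) ^ w j ≤ L := by exact_mod_cast h1
          rw [one_div, inv_pow, ← div_eq_mul_inv, one_le_div (by positivity)]
          exact h2
        _ ≤ ∑ j ∈ Finset.range (q ^ (L + 1)), (L : ℝ) * (1 / 2) ^ w j :=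
          Finset.sum_le_sum_of_subset_of_nonneg ((Finset.filter_subset _ _).trans hsub)
            fun _ _ _ => by positivity
        _ ≤ _ := by
          rw [← Finset.mul_sum]
          exact mul_le_mul_of_nonneg_left (hw _) (by positivity)
    have hNL : (q : ℝ) ^ L ≤ N := by exact_mod_cast Nat.pow_log_le_self q hN0
    calc (((Finset.range N).filter (fun j => j ∉ J)).card : ℝ) / N
        _ ≤ L * ((q : ℝ) - 1 / 2) ^ (L + 1) / (q : ℝ) ^ L :=
          div_le_div₀ (mul_nonneg (by positivity) (pow_nonneg (by linarith) _)) hcard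
            (by positivity) hNL
        _ = ((q : ℝ) - 1 / 2) * (L * ρ ^ L) := by rw [div_pow, pow_succ]; ring
  · refine tendsto_atTop_mono' _ ?_ (hφ.mono_left inf_le_left)
    exact mem_inf_of_right (mem_principal.2 fun j hj => (hJ j).1 hj)

end Density

/-! ### Characters as Laurent polynomials. -/

section Characters

theorem zmod_surjective (n : ℕ) [NeZero n] : Function.Surjective (AddChar.zmod n) := by
  intro ψ
  refine ⟨AddChar.zmodAddEquiv.symm (AddChar.circleEquivComplex ψ), ?_⟩
  apply AddChar.circleEquivComplex.injective
  rw [← AddChar.zmodAddEquiv_apply, AddEquiv.apply_symm_apply]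

theorem zmod_apply_mul (n : ℕ) [NeZero n] (a b x : ZMod n) :
    AddChar.zmod n a (b * x) = AddChar.zmod n (b * a) x := by
  simp [AddChar.zmod, mul_left_comm, mul_assoc]

theorem zmod_sum (n : ℕ) [NeZero n] {κ : Type*} (s : Finset κ) (a : κ → ZMod n) (x : ZMod n) :
    AddChar.zmod n (∑ k ∈ s, a k) x = ∏ k ∈ s, AddChar.zmod n (a k) x := by
  classical
  induction s using Finset.induction_on with
  | empty => simp
  | insert k s hk ih => simp [Finset.sum_insert hk, Finset.prod_insert hk, ih]

theorem addChar_map_sum {A B κ : Type*} [AddCommMonoid A] [CommMonoid B] (ψ : AddChar A B)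
    (s : Finset κ) (a : κ → A) : ψ (∑ k ∈ s, a k) = ∏ k ∈ s, ψ (a k) := by
  classical
  induction s using Finset.induction_on with
  | empty => simp
  | insert k s hk ih =>
    rw [Finset.sum_insert hk, Finset.prod_insert hk, AddChar.map_add_eq_mul, ih]

theorem component_apply {A M : Type*} [AddCommGroup A] [DecidableEq M]
    (χ : AddChar (M → A) Circle) (m : M) (x : A) : component χ m x = χ (Pi.single m x) := by
  simp only [component, AddChar.compAddMonoidHom_apply, AddMonoidHom.single_apply]
  congr!

/-- A continuous character all of whose components are trivial is trivial. -/
theorem eq_one_of_component_eq_one {n : ℕ} {M : Type*} {χ : AddChar (M → ZMod n) Circle} (hχ : Continuous χ)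
    (h : ∀ m, component χ m = 1) : χ = 1 := by
  classical
  ext1 a
  -- Finitely supported truncations converge to `a` in the product topology, so continuity
  -- determines `χ a`.
  have hsum : Tendsto (fun s : Finset M => ∑ m ∈ s, (Pi.single m (a m) : M → ZMod n)) atTop
      (𝓝 a) := by
    refine tendsto_pi_nhds.2 fun k => tendsto_const_nhds.congr' ?_
    filter_upwards [eventually_ge_atTop {k}] with s hs
    have hk : k ∈ s := hs (Finset.mem_singleton_self k)
    simp [Finset.sum_apply, Pi.single_apply, hk]
  have hone : ∀ s : Finset M, χ (∑ m ∈ s, (Pi.single m (a m) : M → ZMod n)) = 1 := by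
    intro s
    rw [addChar_map_sum]
    refine Finset.prod_eq_one fun m _ => ?_
    rw [← component_apply, h m, AddChar.one_apply]
  have hlim := (hχ.tendsto a).comp hsum
  exact tendsto_nhds_unique hlim (tendsto_const_nhds.congr fun s => (hone s).symm)

variable {n : ℕ} [NeZero n] {M : Type*}

/-- The element `G` of the group algebra lists the exponents of the components of `χ`. -/
def Represents (χ : AddChar (M → ZMod n) Circle) (G : AddMonoidAlgebra (ZMod n) M) : Prop :=
  ∀ m, component χ m = AddChar.zmod n (G.coeff m)

theorem Represents.rank_eq {χ : AddChar (M → ZMod n) Circle} {G : AddMonoidAlgebra (ZMod n) M}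
    (h : Represents χ G) : rank χ = numTerms G := by
  rw [rank, numTerms, ← Set.ncard_coe_finset]
  congr 1
  ext m
  rw [Set.mem_ofPred_eq, h m, ← AddChar.zmod_zero n, Ne, AddChar.zmod_injective.eq_iff]
  simp

variable [AddCommGroup M]

theorem exists_represents {χ : AddChar (M → ZMod n) Circle} (hχ : Continuous χ) :
    ∃ G, Represents χ G := by
  choose G hG using fun m => zmod_surjective n (component χ m)
  have hfin : (Function.support G).Finite := by
    refine (finite_components hχ).subset fun m hm h => hm ?_
    rw [← hG, ← AddChar.zmod_zero n] at h
    exact AddChar.zmod_injective h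
  exact ⟨.ofCoeff (Finsupp.ofSupportFinite G hfin), fun m => (hG m).symm⟩

theorem Represents.ne_zero {χ : AddChar (M → ZMod n) Circle} {G : AddMonoidAlgebra (ZMod n) M}
    (h : Represents χ G) (hχ : Continuous χ) (h1 : χ ≠ 1) : G ≠ 0 := by
  rintro rfl
  exact h1 (eq_one_of_component_eq_one hχ fun m => by rw [h m]; simp)

/-- `σ^u` moves a configuration supported at `m` to `m - u`, so the new exponent at `m` is `∑ f_u
G_(m-u)`, a convolution. -/
theorem Represents.comp {χ : AddChar (M → ZMod n) Circle}
    {G : AddMonoidAlgebra (ZMod n) M} (h : Represents χ G) {F : AddMonoid.End (M → ZMod n)}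
    {f : M →₀ ZMod n} (hF : IsShiftPolynomial F f) :
    Represents (χ.compAddMonoidHom F) (.ofCoeff f * G) := by
  classical
  intro m
  ext1 x
  have hshift : ∀ u c, c • shift u (Pi.single m x : M → ZMod n) = Pi.single (-u + m) (c * x) := by
    intro u c
    funext k
    have : u + k = m ↔ k = -u + m := by rw [eq_neg_add_iff_add_eq]
    simp [shift, Pi.single_apply, this]
  rw [component_apply]
  change χ (F (Pi.single m x)) = _
  rw [hF, AddMonoidAlgebra.coeff_mul_apply_left,
    Finsupp.sum, Finsupp.sum, addChar_map_sum, zmod_sum]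
  refine Finset.prod_congr rfl fun u _ => ?_
  rw [hshift, ← component_apply, h, zmod_apply_mul]

theorem Represents.comp_pow {χ : AddChar (M → ZMod n) Circle}
    {G : AddMonoidAlgebra (ZMod n) M} (h : Represents χ G) {F : AddMonoid.End (M → ZMod n)}
    {f : M →₀ ZMod n} (hF : IsShiftPolynomial F f) (j : ℕ) :
    Represents (χ.compAddMonoidHom (F ^ j)) (G * .ofCoeff f ^ j) := by
  induction j with
  | zero =>
    rw [pow_zero, pow_zero, mul_one]
    exact h
  | succ j ih =>
    have := ih.comp hF
    rwa [mul_left_comm, ← pow_succ'] at this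

end Characters

end CellAut

theorem mainTheorem1 (p : ℕ) [Fact p.Prime] (D : ℕ) (hD : 1 ≤ D)
    (F : AddMonoid.End ((Fin D → ℤ) → ZMod p))
    (hF : CellAut.IsLinearCA F) (hnt : CellAut.IsNontrivial F) :
    CellAut.IsDiffusiveInDensity F := by
  intro χ hχ hχ1
  obtain ⟨f, hFf, hf2⟩ := hnt
  obtain ⟨G, hG⟩ := CellAut.exists_represents hχ
  obtain ⟨a, ha⟩ := CellAut.exists_inBox (AddMonoidAlgebra.ofCoeff f)
  obtain ⟨b, hb⟩ := CellAut.exists_inBox G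
  have hp : 1 < p := (Fact.out : p.Prime).one_lt
  -- The box of size `max a b` contains the exponents of both `f` and `G`.
  obtain ⟨s, hs⟩ := pow_unbounded_of_one_lt (4 * max a b + 1) hp
  obtain ⟨J, hJ1, hJ⟩ := CellAut.exists_density_one_tendsto_atTop (q := p ^ s) (by omega)
    fun n => CellAut.sum_half_pow_numTerms_le (ha.mono (le_max_left a b)) hf2 hs n
      (hG.ne_zero hχ hχ1) (hb.mono (le_max_right a b))
  refine ⟨J, hJ1, hJ.congr fun j => ?_⟩
  exact ((hG.comp_pow hFf j).rank_eq).symm
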